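/- Let $N$ and $X$ be non-empty Hermitian manifolds of complex dimension at least $1$, i.e. complex manifolds with smooth Riemannian metrics $g$ on $N$ and $h$ on $X$ for which the complex structures $J$ are isometries of every tangent space. Then the following are equivalent: (a) every local $\pm$holomorphic map from $N$ to $X$, i.e. every smooth map $\phi : U \to X$ defined on an open subset $U \subseteq N$ with $d\phi\circ J = J\circ d\phi$ on all of $U$ or $d\phi\circ J = -J\circ d\phi$ on all of $U$, is $(1,1)$-geodesic; (b) both $N$ and $X$ are Kähler, i.e. the fundamental $2$-forms $\omega(v,w) = g(Jv,w)$ of $N$ and $h(Jv,w)$ of $X$ are closed. Here a smooth map $\phi$ is called $(1,1)$-geodesic if the $(1,1)$-part of its second fundamental form vanishes: $\nabla d\phi(Z,\overline{W}) = 0$ for all tangent vectors $Z, W$ of type $(1,0)$ at the same point, where $\nabla d\phi$ is extended complex-bilinearly; in local coordinates $$\nabla d\phi(v,w) = D^2\phi(v,w) - D\phi\big({}^N\Gamma(v,w)\big) + {}^X\Gamma\big(D\phi\, v, D\phi\, w\big),$$ with ${}^N\Gamma$, ${}^X\Gamma$ the Christoffel symbols of the Levi-Civita connections of $g$ and $h$.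 -/

import Mathlib

open Set
open scoped Manifold ContDiff TensorProduct

noncomputable section

/-! ### Local Riemannian geometry on a real normed space -/

section Coordinates

variable {V : Type*} [NormedAddCommGroup V] [NormedSpace ℝ V]
  {W : Type*} [NormedAddCommGroup W] [NormedSpace ℝ W]

/-- The right-hand side of the Koszul formula for constant vector fields `v`, `w`, where `D` is the
derivative of the metric: `z ↦ (D v (w, z) + D w (v, z) - D z (v, w)) / 2`. -/
def koszulForm (D : V →L[ℝ] V →L[ℝ] V →L[ℝ] ℝ) (v w : V) : V →L[ℝ] ℝ :=
  (1 / 2 : ℝ) • (D v w + D w v - (D.flip v).flip w)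

theorem koszulForm_apply (D : V →L[ℝ] V →L[ℝ] V →L[ℝ] ℝ) (v w z : V) :
    koszulForm D v w z = (1 / 2) * (D v w z + D w v z - D z v w) := rfl

/-- The Christoffel symbols of the Levi-Civita connection of a metric `G` on (an open subset of) a
vector space: `Γ(v, w) = ∇_v w` for the constant vector fields `v`, `w`, which the Koszul formula
determines by `2 G(Γ(v, w), z) = ∂_v G(w, z) + ∂_w G(v, z) - ∂_z G(v, w)` for all `z`. -/
def christoffelSymbols (G : V → V →L[ℝ] V →L[ℝ] ℝ) (u : V) : V →ₗ[ℝ] V →ₗ[ℝ] V :=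
  LinearMap.mk₂ ℝ
    (fun v w => (G u).inverse (koszulForm (fderiv ℝ G u) v w))
    (fun v₁ v₂ w => by
      rw [← map_add]; congr 1; ext z; simp only [koszulForm_apply, map_add, add_apply]; ring)
    (fun c v w => by
      rw [← map_smul]; congr 1; ext z
      simp only [koszulForm_apply, map_smul, smul_apply, smul_eq_mul]; ring)
    (fun v w₁ w₂ => by
      rw [← map_add]; congr 1; ext z; simp only [koszulForm_apply, map_add, add_apply]; ring)
    (fun c v w => by
      rw [← map_smul]; congr 1; ext z
      simp only [koszulForm_apply, map_smul, smul_apply, smul_eq_mul]; ring)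

/-- The second fundamental form `∇df` of a map `f` between (open subsets of) vector spaces, with
respect to connections with Christoffel symbols `Γ` on the source and `Γ'` on the target:
`∇df(v, w) = D²f(v, w) - Df(Γ(v, w)) + Γ'(Df v, Df w)`. -/
def covariantHessian (Γ : V → V →ₗ[ℝ] V →ₗ[ℝ] V) (Γ' : W → W →ₗ[ℝ] W →ₗ[ℝ] W) (f : V → W) (u : V) :
    V →ₗ[ℝ] V →ₗ[ℝ] W :=
  LinearMap.mk₂ ℝ
    (fun v w => fderiv ℝ (fderiv ℝ f) u v w - fderiv ℝ f u (Γ u v w)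
      + Γ' (f u) (fderiv ℝ f u v) (fderiv ℝ f u w))
    (fun v₁ v₂ w => by simp; abel)
    (fun c v w => by simp [smul_add, smul_sub])
    (fun v w₁ w₂ => by simp; abel)
    (fun c v w => by simp [smul_add, smul_sub])

end Coordinates

/-! ### Complex manifolds

A complex manifold is a `ChartedSpace E M`, with `E` a finite-dimensional complex vector space,
whose changes of charts are holomorphic: `IsManifold 𝓘(ℂ, E) ω M`. -/

section ComplexManifold

variable {E : Type*} [NormedAddCommGroup E] [NormedSpace ℂ E]
  {M : Type*} [TopologicalSpace M] [ChartedSpace E M]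

/-- A complex manifold is a real (analytic, in particular smooth) manifold. -/
instance IsManifold.realOfComplex [IsManifold 𝓘(ℂ, E) ω M] : IsManifold 𝓘(ℝ, E) ω M := by
  apply isManifold_of_contDiffOn
  intro e e' he he'
  have h := HasGroupoid.compatible (G := contDiffGroupoid ω 𝓘(ℂ, E)) he he'
  have h1 : ContDiffOn ℂ ω _ _ := (mem_groupoid_of_pregroupoid.1 h).1
  exact h1.restrict_scalars ℝ

/-- Multiplication by `i` on a complex vector space, as a real endomorphism. -/
def mulI (E : Type*) [NormedAddCommGroup E] [NormedSpace ℂ E] : E →L[ℝ] E :=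
  Complex.I • ContinuousLinearMap.id ℝ E

theorem mulI_mulI (E : Type*) [NormedAddCommGroup E] [NormedSpace ℂ E] (v : E) :
    mulI E (mulI E v) = -v := by
  simp [mulI, smul_smul]

/-- The complex structure `J` on the tangent spaces of a complex manifold, as an endomorphism of
the real tangent space. By definition `TangentSpace 𝓘(ℝ, E) x` is the model space `E`, identified
with the tangent space through the preferred chart at `x`, which is holomorphic; so `J` is
multiplication by `i`. -/
def complexStructure (x : M) :
    TangentSpace 𝓘(ℝ, E) x →L[ℝ] TangentSpace 𝓘(ℝ, E) x :=
  mulI E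

end ComplexManifold

/-! ### Real maps and complexified tangent vectors -/

section Complexification

/-- The endomorphism `J` (multiplication by `i`) of the real vector space underlying `E`, extended
complex-linearly to the complexification `ℂ ⊗[ℝ] E`. -/
def complexifiedJ (E : Type*) [NormedAddCommGroup E] [NormedSpace ℂ E] :
    Module.End ℂ (ℂ ⊗[ℝ] E) :=
  LinearMap.baseChange ℂ (mulI E : E →ₗ[ℝ] E)

/-- The space of vectors of type `(1,0)`: the eigenspace of `J` for the eigenvalue `i`. -/
def vectors10 (E : Type*) [NormedAddCommGroup E] [NormedSpace ℂ E] : Submodule ℂ (ℂ ⊗[ℝ] E) :=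
  (complexifiedJ E).eigenspace Complex.I

/-- The space of vectors of type `(0,1)`: the eigenspace of `J` for the eigenvalue `-i`.
Equivalently, the conjugates of the vectors of type `(1,0)`. -/
def vectors01 (E : Type*) [NormedAddCommGroup E] [NormedSpace ℂ E] : Submodule ℂ (ℂ ⊗[ℝ] E) :=
  (complexifiedJ E).eigenspace (-Complex.I)

end Complexification

/-! ### Hermitian metrics, the fundamental form, Kähler metrics -/

section Hermitian

variable (E : Type*) [NormedAddCommGroup E] [NormedSpace ℂ E]
  (M : Type*) [TopologicalSpace M] [ChartedSpace E M] [IsManifold 𝓘(ℂ, E) ω M]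

/-- A Hermitian metric on a complex manifold: a smooth Riemannian metric for which `J` is an
isometry of every tangent space. -/
structure HermitianMetric extends
    Bundle.ContMDiffRiemannianMetric 𝓘(ℝ, E) ∞ E (fun x : M => TangentSpace 𝓘(ℝ, E) x) where
  inner_complexStructure (x : M) (v w : TangentSpace 𝓘(ℝ, E) x) :
    inner x (complexStructure x v) (complexStructure x w) = inner x v w

variable {E M}

namespace HermitianMetric

/-- The fundamental 2-form `ω(v, w) = g(Jv, w)` of a Hermitian metric `g`. -/
def fundamentalForm (g : HermitianMetric E M) (x : M) :
    TangentSpace 𝓘(ℝ, E) x [⋀^Fin 2]→L[ℝ] ℝ where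
  toFun v := g.inner x (complexStructure x (v 0)) (v 1)
  map_update_add' v i a b := by
    fin_cases i <;> simp [Function.update_of_ne]
  map_update_smul' v i c a := by
    fin_cases i <;> simp [Function.update_of_ne]
  map_eq_zero_of_eq' v i j hv hij := by
    have hv' : v 0 = v 1 := by
      fin_cases i <;> fin_cases j <;> simp_all
    have h1 := g.inner_complexStructure x (complexStructure x (v 1)) (v 1)
    have h2 : complexStructure x (complexStructure x (v 1)) = -(v 1) :=
      mulI_mulI E (v 1)
    have h3 := g.symm x (v 1) (complexStructure x (v 1))
    simp only [h2, map_neg, neg_apply] at h1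
    rw [hv']
    linarith
  cont := by
    have h : Continuous fun p : E × E =>
        ((g.inner x).comp (complexStructure x) : E →L[ℝ] E →L[ℝ] ℝ) p.1 p.2 :=
      ContinuousLinearMap.continuous₂ _
    have h' : Continuous fun v : Fin 2 → E => (v 0, v 1) :=
      (continuous_apply 0).prodMk (continuous_apply 1)
    exact h.comp h'

/-- The coordinate expression of the metric in a chart `e`: the bilinear form
`(v, w) ↦ g(v, w)` at the point with coordinates `u`, where `v`, `w` are vectors of the model space,
regarded as tangent vectors through the chart. -/
def inChart (g : HermitianMetric E M) (e : OpenPartialHomeomorph M E) (u : E) :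
    E →L[ℝ] E →L[ℝ] ℝ :=
  let d : E →L[ℝ] E := mfderiv 𝓘(ℝ, E) 𝓘(ℝ, E) e.symm u
  let b : E →L[ℝ] E →L[ℝ] ℝ := g.inner (e.symm u)
  b.bilinearComp d d

/-- The coordinate expression of the fundamental form in a chart `e`: its pull-back by `e.symm`. -/
def fundamentalFormInChart (g : HermitianMetric E M) (e : OpenPartialHomeomorph M E) (u : E) :
    E [⋀^Fin 2]→L[ℝ] ℝ :=
  (g.fundamentalForm (e.symm u)).compContinuousLinearMap (mfderiv 𝓘(ℝ, E) 𝓘(ℝ, E) e.symm u)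

/-- A Hermitian metric on a complex manifold is Kähler if its fundamental form is closed
(the complex structure of a complex manifold is integrable by definition). -/
def IsKaehler (g : HermitianMetric E M) : Prop :=
  ∀ e ∈ IsManifold.maximalAtlas 𝓘(ℂ, E) ω M, ∀ u ∈ e.target,
    extDeriv (g.fundamentalFormInChart e) u = 0

/-- The Christoffel symbols, in the chart `e`, of the Levi-Civita connection of `g`. -/
def christoffel (g : HermitianMetric E M) (e : OpenPartialHomeomorph M E) (u : E) :
    E →ₗ[ℝ] E →ₗ[ℝ] E :=
  christoffelSymbols (g.inChart e) u

end HermitianMetric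

end Hermitian

/-! ### ±Holomorphic maps and (1,1)-geodesic maps -/

section Maps

variable {E : Type*} [NormedAddCommGroup E] [NormedSpace ℂ E]
  {F : Type*} [NormedAddCommGroup F] [NormedSpace ℂ F]
  {N : Type*} [TopologicalSpace N] [ChartedSpace E N]
  {X : Type*} [TopologicalSpace X] [ChartedSpace F X]

/-- `φ` is holomorphic on the open set `U`: it is smooth and `dφ ∘ J = J ∘ dφ`. -/
def IsHolomorphicOn (φ : N → X) (U : Set N) : Prop :=
  ContMDiffOn 𝓘(ℝ, E) 𝓘(ℝ, F) ∞ φ U ∧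
    ∀ x ∈ U, ∀ v : TangentSpace 𝓘(ℝ, E) x,
      mfderiv 𝓘(ℝ, E) 𝓘(ℝ, F) φ x (complexStructure x v) =
        complexStructure (φ x) (mfderiv 𝓘(ℝ, E) 𝓘(ℝ, F) φ x v)

/-- `φ` is antiholomorphic on the open set `U`: it is smooth and `dφ ∘ J = -J ∘ dφ`. -/
def IsAntiholomorphicOn (φ : N → X) (U : Set N) : Prop :=
  ContMDiffOn 𝓘(ℝ, E) 𝓘(ℝ, F) ∞ φ U ∧
    ∀ x ∈ U, ∀ v : TangentSpace 𝓘(ℝ, E) x,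
      mfderiv 𝓘(ℝ, E) 𝓘(ℝ, F) φ x (complexStructure x v) =
        -complexStructure (φ x) (mfderiv 𝓘(ℝ, E) 𝓘(ℝ, F) φ x v)

variable [IsManifold 𝓘(ℂ, E) ω N] [IsManifold 𝓘(ℂ, F) ω X]

/-- The second fundamental form `∇dφ` of a map `φ` between Hermitian manifolds, in charts `e` of the
source and `e'` of the target, at the point with coordinates `u`. -/
def secondFundamentalForm (g : HermitianMetric E N) (h : HermitianMetric F X) (φ : N → X)
    (e : OpenPartialHomeomorph N E) (e' : OpenPartialHomeomorph X F) (u : E) :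
    E →ₗ[ℝ] E →ₗ[ℝ] F :=
  covariantHessian (g.christoffel e) (h.christoffel e') (e' ∘ φ ∘ e.symm) u

/-- `φ` is (1,1)-geodesic on the open set `U`: it is smooth there, and the complex bilinear extension
of its second fundamental form satisfies `∇dφ(Z, W̄) = 0` for all `Z`, `W` of type `(1,0)`, at every
point of `U` and in all holomorphic charts of the source and of the target around it and its
image. -/
def IsOneOneGeodesicOn (g : HermitianMetric E N) (h : HermitianMetric F X)
    (φ : N → X) (U : Set N) : Prop :=
  ContMDiffOn 𝓘(ℝ, E) 𝓘(ℝ, F) ∞ φ U ∧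
    ∀ x ∈ U, ∀ e ∈ IsManifold.maximalAtlas 𝓘(ℂ, E) ω N, x ∈ e.source →
      ∀ e' ∈ IsManifold.maximalAtlas 𝓘(ℂ, F) ω X, φ x ∈ e'.source →
        ∀ Z ∈ vectors10 E, ∀ W ∈ vectors01 E,
          LinearMap.BilinMap.baseChange ℂ (secondFundamentalForm g h φ e e' (e x)) Z W = 0

end Maps

end

open Set
open scoped Manifold ContDiff TensorProduct

noncomputable section

/-! ### The (1,1)-part of a real bilinear map. -/

section ComplexBilinear

variable {E : Type*} [NormedAddCommGroup E] [NormedSpace ℂ E]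
  {F : Type*} [NormedAddCommGroup F] [NormedSpace ℂ F]

/-! The (1,1)-part of a real bilinear map `B` vanishes iff `B(v, w) + B(Jv, Jw) = 0`
(`baseChange_eq_zero_iff`). Write `A(v, w) = Γ(v, w) + Γ(Jv, Jw)` for the Christoffel symbols in a
holomorphic chart. The Koszul formula expresses `A` through `dω`, and `dω = 0` at a point iff `A =
0` there (`extDerivFundamental_eq_zero_iff`); so Kähler means `A = 0` in all holomorphic charts
(`HermitianMetric.isKaehler_iff`).

If `f` is the coordinate expression of a ±holomorphic map, then `D²f(Jv, Jw) = -D²f(v, w)`, so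
second derivatives drop out of the (1,1)-part of `∇df`, leaving `A_X(Df v, Df w) - Df(A_N(v, w))`
(`secondFundamentalForm_add_mulI`). This is zero when both manifolds are Kähler.

Conversely, maps affine in charts realise every complex linear `L` as a differential between any two
points, so `A_X(Lv, Lw) = L(A_N(v, w))` for all `L` (`christoffel_intertwining`). The left side is
quadratic in `L`, the right side linear; replacing `L` by `2L` forces `L(A_N(v, w)) = 0`, hence `A_N
= 0`. Rank-one `L` then give `A_X(y, y) = 0`, and polarization gives `A_X = 0`. -/

theorem tmul_sub_mem_vectors10 (c : ℂ) (v : E) :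
    c ⊗ₜ[ℝ] v - (Complex.I * c) ⊗ₜ[ℝ] mulI E v ∈ vectors10 E := by
  rw [vectors10, Module.End.mem_eigenspace_iff]
  simp only [complexifiedJ, map_sub, LinearMap.baseChange_tmul, ContinuousLinearMap.coe_coe,
    mulI_mulI, smul_sub, TensorProduct.smul_tmul', smul_eq_mul, ← mul_assoc, Complex.I_mul_I,
    TensorProduct.tmul_neg, neg_mul, one_mul, TensorProduct.neg_tmul]
  abel

theorem tmul_add_mem_vectors01 (c : ℂ) (v : E) :
    c ⊗ₜ[ℝ] v + (Complex.I * c) ⊗ₜ[ℝ] mulI E v ∈ vectors01 E := by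
  rw [vectors01, Module.End.mem_eigenspace_iff]
  simp only [complexifiedJ, map_add, LinearMap.baseChange_tmul, ContinuousLinearMap.coe_coe,
    mulI_mulI, smul_add, neg_smul, TensorProduct.smul_tmul', smul_eq_mul, ← mul_assoc,
    Complex.I_mul_I, TensorProduct.tmul_neg, neg_mul, one_mul, TensorProduct.neg_tmul]
  abel

theorem baseChange_vectors10_vectors01 (B : E →ₗ[ℝ] E →ₗ[ℝ] F) (c d : ℂ) (v w : E) :
    LinearMap.BilinMap.baseChange ℂ B (c ⊗ₜ[ℝ] v - (Complex.I * c) ⊗ₜ[ℝ] mulI E v)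
      (d ⊗ₜ[ℝ] w + (Complex.I * d) ⊗ₜ[ℝ] mulI E w) =
    (d * c) ⊗ₜ[ℝ] (B v w + B (mulI E v) (mulI E w)) +
      (Complex.I * (d * c)) ⊗ₜ[ℝ] (B v (mulI E w) + B (mulI E v) (mulI E (mulI E w))) := by
  simp only [map_add, map_sub, LinearMap.sub_apply, LinearMap.BilinMap.baseChange_tmul, mulI_mulI,
    map_neg, TensorProduct.tmul_add, TensorProduct.tmul_neg]
  have h1 : Complex.I * c * d = Complex.I * (d * c) := by ring
  have h2 : c * (Complex.I * d) = Complex.I * (d * c) := by ring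
  have h3 : Complex.I * c * (Complex.I * d) = -(d * c) := by
    linear_combination (d * c) * Complex.I_mul_I
  rw [h1, h2, h3, mul_comm c d, TensorProduct.neg_tmul]
  abel

/-- Apply the real part to the complex factor. -/
theorem one_tmul_add_I_tmul_eq_zero {x y : F}
    (h : (1 : ℂ) ⊗ₜ[ℝ] x + Complex.I ⊗ₜ[ℝ] y = 0) : x = 0 := by
  have := congrArg ((TensorProduct.lid ℝ F).toLinearMap ∘ₗ LinearMap.rTensor F Complex.reLm) h
  simpa using this

/-- `(1 - iJ)/2` is the projection onto the `i`-eigenspace of `J`. Writing `Z` as a projection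
reduces claims about type (1,0) vectors to projections of pure tensors. -/
theorem eq_half_smul_of_mem_vectors10 {Z : ℂ ⊗[ℝ] E} (hZ : Z ∈ vectors10 E) :
    Z = (1 / 2 : ℂ) • (Z - Complex.I • complexifiedJ E Z) := by
  rw [vectors10, Module.End.mem_eigenspace_iff] at hZ
  rw [hZ, smul_smul, Complex.I_mul_I, smul_sub, smul_smul, ← sub_smul]
  norm_num

theorem eq_half_smul_of_mem_vectors01 {Z : ℂ ⊗[ℝ] E} (hZ : Z ∈ vectors01 E) :
    Z = (1 / 2 : ℂ) • (Z + Complex.I • complexifiedJ E Z) := by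
  rw [vectors01, Module.End.mem_eigenspace_iff] at hZ
  rw [hZ, smul_smul, mul_neg, Complex.I_mul_I, smul_add, smul_smul, ← add_smul]
  norm_num

/-- The `(1,1)`-part of a bilinear map vanishes if and only if the map is anti-invariant
under `J`. -/
theorem baseChange_eq_zero_iff (B : E →ₗ[ℝ] E →ₗ[ℝ] F) :
    (∀ Z ∈ vectors10 E, ∀ W ∈ vectors01 E, LinearMap.BilinMap.baseChange ℂ B Z W = 0) ↔
      ∀ v w, B v w + B (mulI E v) (mulI E w) = 0 := by
  constructor
  · intro h v w
    have h1 := h _ (tmul_sub_mem_vectors10 1 v) _ (tmul_add_mem_vectors01 1 w)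
    rw [baseChange_vectors10_vectors01] at h1
    simp only [mul_one] at h1
    exact one_tmul_add_I_tmul_eq_zero h1
  · intro h Z hZ W hW
    -- Up to the factors 1/2, the arguments are projections of arbitrary tensors, so bilinearity
    -- reduces the claim to pure tensors.
    have key : ∀ Z W : ℂ ⊗[ℝ] E, LinearMap.BilinMap.baseChange ℂ B
        (Z - Complex.I • complexifiedJ E Z) (W + Complex.I • complexifiedJ E W) = 0 := by
      intro Z W
      induction Z with
      | zero => simp
      | add a b ha hb =>
        rw [show a + b - Complex.I • complexifiedJ E (a + b) =
          (a - Complex.I • complexifiedJ E a) + (b - Complex.I • complexifiedJ E b) by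
            rw [map_add, smul_add]; abel, LinearMap.map_add₂, ha, hb, add_zero]
      | tmul c v =>
        induction W with
        | zero => simp
        | add a b ha hb =>
          rw [show a + b + Complex.I • complexifiedJ E (a + b) =
            (a + Complex.I • complexifiedJ E a) + (b + Complex.I • complexifiedJ E b) by
              rw [map_add, smul_add]; abel, map_add, ha, hb, add_zero]
        | tmul d w =>
          have := baseChange_vectors10_vectors01 B c d v w
          rw [h v w, h v (mulI E w)] at this
          simpa [complexifiedJ, TensorProduct.smul_tmul'] using this
    rw [eq_half_smul_of_mem_vectors10 hZ, eq_half_smul_of_mem_vectors01 hW, map_smul, map_smul,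
      LinearMap.smul_apply, key, smul_zero, smul_zero]

end ComplexBilinear

/-! ### The Koszul formula and the exterior derivative of the fundamental form. -/

section KoszulFundamentalForm

variable {E : Type*} [NormedAddCommGroup E] [NormedSpace ℂ E]

/-- The exterior derivative of the fundamental form `G(J·, ·)` of a metric `G` with derivative `D`,
as an alternating sum. -/
def extDerivFundamental (D : E →L[ℝ] E →L[ℝ] E →L[ℝ] ℝ) (a b c : E) : ℝ :=
  D a (mulI E b) c - D b (mulI E a) c + D c (mulI E a) b

variable {D : E →L[ℝ] E →L[ℝ] E →L[ℝ] ℝ}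

theorem mulI_skew (hJ : ∀ a v w, D a (mulI E v) (mulI E w) = D a v w) (a v w : E) :
    D a v (mulI E w) = -D a (mulI E v) w := by
  rw [← hJ a v (mulI E w), mulI_mulI, map_neg]

/-- Expand both sides: the terms of `dω` differentiating along `z` combine by `J`-invariance and
symmetry of the metric, and the terms along `Jv` and `Jw` match directly. -/
theorem koszulForm_add_koszulForm_mulI (hs : ∀ a v w, D a v w = D a w v)
    (hJ : ∀ a v w, D a (mulI E v) (mulI E w) = D a v w) (v w z : E) :
    koszulForm D v w z + koszulForm D (mulI E v) (mulI E w) z =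
      -(1 / 2) * (extDerivFundamental D v (mulI E w) z +
        extDerivFundamental D w (mulI E v) z) := by
  simp only [koszulForm_apply, extDerivFundamental, mulI_mulI, map_neg, neg_apply, hJ]
  rw [hs z w v]
  ring

/-- For the converse, vanishing of the Koszul sum lets `J` move freely between the slots of `T =
dω`, so inserting `J` in two slots changes the sign. But `ω` has type (1,1), so `dω` has no (3,0) or
(0,3) part, which expresses `T` as the sum of its three double insertions. Hence `T = -3T`. -/
theorem extDerivFundamental_eq_zero_iff (hs : ∀ a v w, D a v w = D a w v)
    (hJ : ∀ a v w, D a (mulI E v) (mulI E w) = D a v w) :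
    (∀ a b c, extDerivFundamental D a b c = 0) ↔
      ∀ v w z, koszulForm D v w z + koszulForm D (mulI E v) (mulI E w) z = 0 := by
  constructor
  · intro h v w z
    rw [koszulForm_add_koszulForm_mulI hs hJ, h, h]
    ring
  · intro h
    set T := extDerivFundamental D with hT
    have hJ' := mulI_skew hJ
    have h12 : ∀ a b c, T a b c = -T b a c := by
      intro a b c
      simp only [hT, extDerivFundamental]
      rw [hs c (mulI E a) b, hJ' c b a]; ring
    have h23 : ∀ a b c, T a b c = -T a c b := by
      intro a b c
      simp only [hT, extDerivFundamental]
      rw [hs a (mulI E b) c, hJ' a c b]; ring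
    have hA : ∀ v w z, T v (mulI E w) z = T (mulI E v) w z := by
      intro v w z
      have := h v w z
      rw [koszulForm_add_koszulForm_mulI hs hJ, ← hT] at this
      rw [h12 w (mulI E v) z] at this
      linarith
    have hB : ∀ a b c, T a (mulI E b) c = T a b (mulI E c) := by
      intro a b c
      rw [hA, h23 a b, hA, h23 _ c b, neg_neg]
    -- This is the absence of a (3,0) + (0,3) part; it uses only the symmetries of `D`, not the
    -- hypothesis `h`.
    have h4 : ∀ a b c, T a b c = T (mulI E a) (mulI E b) c + T (mulI E a) b (mulI E c) +
        T a (mulI E b) (mulI E c) := by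
      intro a b c
      simp only [hT, extDerivFundamental, mulI_mulI, map_neg, neg_apply, hJ, hJ']
      ring
    intro a b c
    have e1 : T (mulI E a) (mulI E b) c = -T a b c := by
      rw [← hA, mulI_mulI]
      simp only [hT, extDerivFundamental, map_neg, neg_apply]
      ring
    have e2 := h4 a b c
    rw [← hB (mulI E a), hA a b, ← hB (mulI E a), e1] at e2
    linarith

end KoszulFundamentalForm

/-! ### Complex differentiability viewed over the reals. -/

section RestrictScalars

variable {E : Type*} [NormedAddCommGroup E] [NormedSpace ℂ E]
  {F : Type*} [NormedAddCommGroup F] [NormedSpace ℂ F]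
  {N : Type*} [TopologicalSpace N] [ChartedSpace E N]
  {X : Type*} [TopologicalSpace X] [ChartedSpace F X]

theorem HasMFDerivAt.realOfComplex {f : N → X} {x : N} {f' : E →L[ℂ] F}
    (h : HasMFDerivAt 𝓘(ℂ, E) 𝓘(ℂ, F) f x f') :
    HasMFDerivAt 𝓘(ℝ, E) 𝓘(ℝ, F) f x (f'.restrictScalars ℝ : E →L[ℝ] F) :=
  ⟨h.1, HasFDerivWithinAt.restrictScalars ℝ h.2⟩

theorem MDifferentiableAt.realOfComplex {f : N → X} {x : N}
    (h : MDifferentiableAt 𝓘(ℂ, E) 𝓘(ℂ, F) f x) : MDifferentiableAt 𝓘(ℝ, E) 𝓘(ℝ, F) f x :=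
  (HasMFDerivAt.realOfComplex h.hasMFDerivAt).mdifferentiableAt

theorem MDifferentiableAt.mfderiv_complexStructure {f : N → X} {x : N}
    (h : MDifferentiableAt 𝓘(ℂ, E) 𝓘(ℂ, F) f x) (v : TangentSpace 𝓘(ℝ, E) x) :
    mfderiv 𝓘(ℝ, E) 𝓘(ℝ, F) f x (complexStructure x v) =
      complexStructure (f x) (mfderiv 𝓘(ℝ, E) 𝓘(ℝ, F) f x v) := by
  rw [(HasMFDerivAt.realOfComplex h.hasMFDerivAt).mfderiv]
  exact (mfderiv 𝓘(ℂ, E) 𝓘(ℂ, F) f x : E →L[ℂ] F).map_smul Complex.I (v : E)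

theorem ContMDiffOn.realOfComplex {f : N → X} {s : Set N} {n : ℕ∞ω}
    (h : ContMDiffOn 𝓘(ℂ, E) 𝓘(ℂ, F) n f s) : ContMDiffOn 𝓘(ℝ, E) 𝓘(ℝ, F) n f s := by
  intro x hx
  have h1 := h x hx
  rw [contMDiffWithinAt_iff] at h1 ⊢
  exact ⟨h1.1, ContDiffWithinAt.restrict_scalars ℝ h1.2⟩

theorem ContMDiffOn.isHolomorphicOn {f : N → X} {s : Set N} (hs : IsOpen s)
    (h : ContMDiffOn 𝓘(ℂ, E) 𝓘(ℂ, F) ω f s) : IsHolomorphicOn (E := E) (F := F) f s :=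
  ⟨(h.realOfComplex).of_le (by simp), fun _ hx v =>
    ((h.contMDiffAt (hs.mem_nhds hx)).mdifferentiableAt (by simp)).mfderiv_complexStructure v⟩

variable [IsManifold 𝓘(ℂ, E) ω N]

theorem mem_maximalAtlas_real {e : OpenPartialHomeomorph N E}
    (he : e ∈ IsManifold.maximalAtlas 𝓘(ℂ, E) ω N) :
    e ∈ IsManifold.maximalAtlas 𝓘(ℝ, E) ω N := by
  rw [IsManifold.mem_maximalAtlas_iff_contMDiffOn] at he ⊢
  exact ⟨he.1.realOfComplex, he.2.realOfComplex⟩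

end RestrictScalars

/-! ### Smoothness of bilinear forms evaluated on sections. -/

section BilinearBundle

variable
  {EB : Type*} [NormedAddCommGroup EB] [NormedSpace ℝ EB]
  {HB : Type*} [TopologicalSpace HB] {IB : ModelWithCorners ℝ EB HB} {n : ℕ∞ω}
  {B : Type*} [TopologicalSpace B] [ChartedSpace HB B]
  {F : Type*} [NormedAddCommGroup F] [NormedSpace ℝ F]
  {E : B → Type*} [TopologicalSpace (Bundle.TotalSpace F E)] [∀ x, AddCommGroup (E x)]
  [∀ x, Module ℝ (E x)] [∀ x, TopologicalSpace (E x)] [FiberBundle F E] [VectorBundle ℝ F E]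
  {EM : Type*} [NormedAddCommGroup EM] [NormedSpace ℝ EM]
  {HM : Type*} [TopologicalSpace HM] {IM : ModelWithCorners ℝ EM HM}
  {M : Type*} [TopologicalSpace M] [ChartedSpace HM M]
  {b : M → B} {g : ∀ x, E x →L[ℝ] E x →L[ℝ] ℝ} {v w : ∀ x, E (b x)} {s : Set M} {x : M}

/-- A smooth family of bilinear forms, applied to smooth sections, is smooth. -/
theorem contMDiffWithinAt_bilinear_bundle_apply
    (hg : ContMDiffWithinAt IM (IB.prod 𝓘(ℝ, F →L[ℝ] F →L[ℝ] ℝ)) n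
      (fun m => Bundle.TotalSpace.mk' (F →L[ℝ] F →L[ℝ] ℝ)
        (E := fun x => E x →L[ℝ] E x →L[ℝ] ℝ) (b m) (g (b m))) s x)
    (hv : ContMDiffWithinAt IM (IB.prod 𝓘(ℝ, F)) n
      (fun m => Bundle.TotalSpace.mk' F (b m) (v m)) s x)
    (hw : ContMDiffWithinAt IM (IB.prod 𝓘(ℝ, F)) n
      (fun m => Bundle.TotalSpace.mk' F (b m) (w m)) s x) :
    ContMDiffWithinAt IM 𝓘(ℝ) n (fun m => g (b m) (v m) (w m)) s x := by
  have : ContMDiffWithinAt IM (IB.prod 𝓘(ℝ)) n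
      (fun m ↦ Bundle.TotalSpace.mk' ℝ (E := Bundle.Trivial B ℝ) (b m)
        (g (b m) (v m) (w m))) s x := by
    apply ContMDiffWithinAt.clm_bundle_apply₂ (F₁ := F) (F₂ := F)
    · exact hg
    · exact hv
    · exact hw
  simp only [Bundle.contMDiffWithinAt_totalSpace] at this
  exact this.2

end BilinearBundle

/-! ### The metric in a holomorphic chart. -/

section InChart

variable {E : Type*} [NormedAddCommGroup E] [NormedSpace ℂ E]
  {N : Type*} [TopologicalSpace N] [ChartedSpace E N]
  {e : OpenPartialHomeomorph N E}

theorem mfderiv_symm_complexStructure (he : e ∈ IsManifold.maximalAtlas 𝓘(ℂ, E) ω N) {u : E}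
    (hu : u ∈ e.target) (v : E) :
    (mfderiv 𝓘(ℝ, E) 𝓘(ℝ, E) e.symm u : E →L[ℝ] E) (mulI E v) =
      mulI E ((mfderiv 𝓘(ℝ, E) 𝓘(ℝ, E) e.symm u : E →L[ℝ] E) v) :=
  ((contMDiffAt_symm_of_mem_maximalAtlas he hu).mdifferentiableAt
    (by simp)).mfderiv_complexStructure v

variable [IsManifold 𝓘(ℂ, E) ω N]

theorem mfderiv_symm_injective (he : e ∈ IsManifold.maximalAtlas 𝓘(ℂ, E) ω N) {u : E}
    (hu : u ∈ e.target) :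
    Function.Injective (mfderiv 𝓘(ℝ, E) 𝓘(ℝ, E) e.symm u : E →L[ℝ] E) := by
  have he' := mem_maximalAtlas_real he
  have h1 : MDifferentiableAt 𝓘(ℝ, E) 𝓘(ℝ, E) e.symm u :=
    (contMDiffAt_symm_of_mem_maximalAtlas he' hu).mdifferentiableAt (by simp)
  have h2 : MDifferentiableAt 𝓘(ℝ, E) 𝓘(ℝ, E) e (e.symm u) :=
    (contMDiffAt_of_mem_maximalAtlas he' (e.map_target hu)).mdifferentiableAt (by simp)
  have h3 := mfderiv_comp u h2 h1
  have h4 : (e ∘ e.symm) =ᶠ[nhds u] id := by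
    filter_upwards [e.open_target.mem_nhds hu] with y hy
    exact e.right_inv hy
  rw [h4.mfderiv_eq, mfderiv_id] at h3
  intro v w hvw
  have h5 := congrArg (mfderiv 𝓘(ℝ, E) 𝓘(ℝ, E) e (e.symm u) : E →L[ℝ] E) hvw
  have h6 : ∀ v : E, v = (mfderiv 𝓘(ℝ, E) 𝓘(ℝ, E) e (e.symm u) : E →L[ℝ] E)
    ((mfderiv 𝓘(ℝ, E) 𝓘(ℝ, E) e.symm u : E →L[ℝ] E) v) :=
    fun v => congrArg (fun L : E →L[ℝ] E => L v) h3
  rw [h6 v, h6 w, h5]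

namespace HermitianMetric

variable (g : HermitianMetric E N)

theorem inChart_apply (e : OpenPartialHomeomorph N E) (u v w : E) :
    g.inChart e u v w = (g.inner (e.symm u) : E →L[ℝ] E →L[ℝ] ℝ)
      ((mfderiv 𝓘(ℝ, E) 𝓘(ℝ, E) e.symm u : E →L[ℝ] E) v)
      ((mfderiv 𝓘(ℝ, E) 𝓘(ℝ, E) e.symm u : E →L[ℝ] E) w) := rfl

theorem inChart_symm (e : OpenPartialHomeomorph N E) (u v w : E) :
    g.inChart e u v w = g.inChart e u w v := by
  rw [inChart_apply, inChart_apply]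
  exact g.symm (e.symm u) _ _

theorem inChart_mulI (he : e ∈ IsManifold.maximalAtlas 𝓘(ℂ, E) ω N) {u : E}
    (hu : u ∈ e.target) (v w : E) :
    g.inChart e u (mulI E v) (mulI E w) = g.inChart e u v w := by
  rw [inChart_apply, inChart_apply, mfderiv_symm_complexStructure he hu,
    mfderiv_symm_complexStructure he hu]
  exact g.inner_complexStructure (e.symm u) _ _

theorem inChart_self_pos (he : e ∈ IsManifold.maximalAtlas 𝓘(ℂ, E) ω N) {u : E}
    (hu : u ∈ e.target) {v : E} (hv : v ≠ 0) : 0 < g.inChart e u v v := by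
  rw [inChart_apply]
  refine g.pos (e.symm u) _ fun h => hv (mfderiv_symm_injective he hu ?_)
  exact h.trans (map_zero (mfderiv 𝓘(ℝ, E) 𝓘(ℝ, E) e.symm u : E →L[ℝ] E)).symm

/-- Positive definiteness gives injectivity, and dimensions agree. Without invertibility the
`inverse` in `christoffelSymbols` would be the default value zero. -/
theorem isInvertible_inChart [FiniteDimensional ℂ E]
    (he : e ∈ IsManifold.maximalAtlas 𝓘(ℂ, E) ω N) {u : E}
    (hu : u ∈ e.target) : (g.inChart e u).IsInvertible := by
  have : FiniteDimensional ℝ E := FiniteDimensional.complexToReal E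
  have hinj : Function.Injective (g.inChart e u) := by
    rw [injective_iff_map_eq_zero]
    intro v hv
    by_contra h0
    have := g.inChart_self_pos he hu h0
    rw [hv] at this
    simp at this
  have hd : Module.finrank ℝ E = Module.finrank ℝ (E →L[ℝ] ℝ) := by
    rw [← (LinearMap.toContinuousLinearMap (𝕜 := ℝ) (E := E) (F' := ℝ)).finrank_eq,
      Module.finrank_linearMap, Module.finrank_self, mul_one]
  exact ⟨(LinearEquiv.ofInjectiveOfFinrankEq (g.inChart e u : E →ₗ[ℝ] E →L[ℝ] ℝ) hinj
    hd).toContinuousLinearEquiv, by ext; rfl⟩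

theorem contDiffOn_inChart_apply (he : e ∈ IsManifold.maximalAtlas 𝓘(ℂ, E) ω N) (v w : E) :
    ContDiffOn ℝ 1 (fun u => g.inChart e u v w) e.target := by
  intro u hu
  have he' := mem_maximalAtlas_real he
  -- The coordinate field `v` is carried by the tangent map of `e.symm` to a `C¹` section along
  -- `e.symm`, on which the bundle metric can be evaluated.
  have hsec : ∀ v : E, ContMDiffWithinAt 𝓘(ℝ, E) (𝓘(ℝ, E).prod 𝓘(ℝ, E)) 1
      (fun u => (⟨e.symm u, mfderiv 𝓘(ℝ, E) 𝓘(ℝ, E) e.symm u v⟩ : TangentBundle 𝓘(ℝ, E) N))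
      e.target u := by
    intro v
    have h1 := (contMDiffOn_symm_of_mem_maximalAtlas he').contMDiffOn_tangentMapWithin
      (m := 1) (by simp) e.open_target.uniqueMDiffOn
    have h2 : ContMDiffWithinAt 𝓘(ℝ, E) (𝓘(ℝ, E).prod 𝓘(ℝ, E)) 1
      (fun u : E => (⟨u, v⟩ : TangentBundle 𝓘(ℝ, E) E)) e.target u := by
      rw [Bundle.contMDiffWithinAt_totalSpace]
      refine ⟨contMDiffWithinAt_id, ?_⟩
      simpa using contMDiffWithinAt_const
    have h3 := ContMDiffWithinAt.comp u (h1 (⟨u, v⟩ : TangentBundle 𝓘(ℝ, E) E) hu) h2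
      (fun y hy => hy)
    refine h3.congr (fun y hy => ?_) ?_
    · simp [tangentMapWithin, mfderivWithin_of_isOpen e.open_target hy]
    · simp [tangentMapWithin, mfderivWithin_of_isOpen e.open_target hu]
  have hg := ((g.contMDiff.of_le (show (1 : ℕ∞ω) ≤ ∞ by
      exact_mod_cast le_top)).contMDiffAt).comp_contMDiffWithinAt u
      ((contMDiffOn_symm_of_mem_maximalAtlas he' u hu).of_le (by simp))
  exact contMDiffWithinAt_iff_contDiffWithinAt.1
    (contMDiffWithinAt_bilinear_bundle_apply (b := e.symm) (g := g.inner)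
      (v := fun y => mfderiv 𝓘(ℝ, E) 𝓘(ℝ, E) e.symm y v)
      (w := fun y => mfderiv 𝓘(ℝ, E) 𝓘(ℝ, E) e.symm y w) hg (hsec v) (hsec w))

theorem differentiableAt_inChart [FiniteDimensional ℂ E]
    (he : e ∈ IsManifold.maximalAtlas 𝓘(ℂ, E) ω N) {u : E}
    (hu : u ∈ e.target) : DifferentiableAt ℝ (g.inChart e) u := by
  have : FiniteDimensional ℝ E := FiniteDimensional.complexToReal E
  exact ((contDiffOn_clm_apply.2 fun v => contDiffOn_clm_apply.2
    (g.contDiffOn_inChart_apply he v)).contDiffAt (e.open_target.mem_nhds hu)).differentiableAt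
    one_ne_zero

end HermitianMetric
end InChart

/-! ### The Kähler condition in terms of Christoffel symbols. -/

section FundamentalForm

/-- The antisymmetrization `(v, w) ↦ B(v, w) - B(w, v)` of a bilinear form, as a continuous linear
map to alternating forms. -/
def antisymmetrization (E : Type*) [NormedAddCommGroup E] [NormedSpace ℝ E] :
    (E →L[ℝ] E →L[ℝ] ℝ) →L[ℝ] E [⋀^Fin 2]→L[ℝ] ℝ :=
  (ContinuousAlternatingMap.alternatizeUncurryFinCLM (n := 1) ℝ E ℝ).comp
    (ContinuousLinearMap.compL ℝ E (E →L[ℝ] ℝ) (E [⋀^Fin 1]→L[ℝ] ℝ)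
      (ContinuousAlternatingMap.ofSubsingletonLIE (0 : Fin 1) :
        (E →L[ℝ] ℝ) ≃ₗᵢ[ℝ] E [⋀^Fin 1]→L[ℝ] ℝ).toContinuousLinearEquiv.toContinuousLinearMap)

theorem antisymmetrization_apply {E : Type*} [NormedAddCommGroup E] [NormedSpace ℝ E]
    (B : E →L[ℝ] E →L[ℝ] ℝ) (v : Fin 2 → E) :
    antisymmetrization E B v = B (v 0) (v 1) - B (v 1) (v 0) := by
  simp [antisymmetrization, ContinuousAlternatingMap.alternatizeUncurryFin_apply,
    ContinuousAlternatingMap.ofSubsingletonLIE, Fin.removeNth, sub_eq_add_neg]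

variable {E : Type*} [NormedAddCommGroup E] [NormedSpace ℂ E]
  {N : Type*} [TopologicalSpace N] [ChartedSpace E N] [IsManifold 𝓘(ℂ, E) ω N]
  {e : OpenPartialHomeomorph N E}

namespace HermitianMetric

variable (g : HermitianMetric E N)

theorem fundamentalFormInChart_apply (he : e ∈ IsManifold.maximalAtlas 𝓘(ℂ, E) ω N) {u : E}
    (hu : u ∈ e.target) (v : Fin 2 → E) :
    g.fundamentalFormInChart e u v = g.inChart e u (mulI E (v 0)) (v 1) := by
  rw [inChart_apply, mfderiv_symm_complexStructure he hu]
  rfl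

theorem inChart_apply_mulI (he : e ∈ IsManifold.maximalAtlas 𝓘(ℂ, E) ω N) {u : E}
    (hu : u ∈ e.target) (v w : E) :
    g.inChart e u v (mulI E w) = -g.inChart e u (mulI E v) w := by
  rw [← g.inChart_mulI he hu, mulI_mulI, map_neg]

/-- The form `G(J·, ·)` is already skew, so half its antisymmetrization is itself. This makes the
fundamental form a continuous linear image of the metric, which transfers differentiability. -/
theorem fundamentalFormInChart_eq (he : e ∈ IsManifold.maximalAtlas 𝓘(ℂ, E) ω N) {u : E}
    (hu : u ∈ e.target) :
    g.fundamentalFormInChart e u =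
      (1 / 2 : ℝ) • antisymmetrization E ((g.inChart e u).comp (mulI E)) := by
  ext v
  rw [g.fundamentalFormInChart_apply he hu, ContinuousAlternatingMap.smul_apply,
    antisymmetrization_apply, ContinuousLinearMap.comp_apply, ContinuousLinearMap.comp_apply,
    g.inChart_symm e u (mulI E (v 1)), g.inChart_apply_mulI he hu, smul_eq_mul]
  ring

variable [FiniteDimensional ℂ E]

theorem differentiableAt_fundamentalFormInChart (he : e ∈ IsManifold.maximalAtlas 𝓘(ℂ, E) ω N)
    {u : E} (hu : u ∈ e.target) : DifferentiableAt ℝ (g.fundamentalFormInChart e) u := by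
  have h1 :=
    ((antisymmetrization E).differentiableAt.comp u
      ((g.differentiableAt_inChart he hu).clm_comp (differentiableAt_const (mulI E)))).const_smul
        (1 / 2 : ℝ)
  refine h1.congr_of_eventuallyEq ?_
  filter_upwards [e.open_target.mem_nhds hu] with y hy using g.fundamentalFormInChart_eq he hy

theorem extDeriv_fundamentalFormInChart_apply (he : e ∈ IsManifold.maximalAtlas 𝓘(ℂ, E) ω N)
    {u : E} (hu : u ∈ e.target) (v : Fin 3 → E) :
    extDeriv (g.fundamentalFormInChart e) u v =
      extDerivFundamental (fderiv ℝ (g.inChart e) u) (v 0) (v 1) (v 2) := by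
  have hd := g.differentiableAt_inChart he hu
  have key : ∀ w : Fin 2 → E, fderiv ℝ (fun y => g.fundamentalFormInChart e y w) u =
      (((fderiv ℝ (g.inChart e) u).flip (mulI E (w 0))).flip (w 1)) := by
    intro w
    have h1 : (fun y => g.fundamentalFormInChart e y w) =ᶠ[nhds u]
        fun y => g.inChart e y (mulI E (w 0)) (w 1) := by
      filter_upwards [e.open_target.mem_nhds hu] with y hy
        using g.fundamentalFormInChart_apply he hy w
    rw [h1.fderiv_eq]
    ext a
    rw [fderiv_clm_apply (hd.clm_apply (differentiableAt_const _)) (differentiableAt_const _),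
      fderiv_clm_apply hd (differentiableAt_const _)]
    simp
  rw [extDeriv_apply (g.differentiableAt_fundamentalFormInChart he hu)]
  have h0 : (0 : Fin (2 + 1)).removeNth v = ![v 1, v 2] := by ext i; fin_cases i <;> rfl
  have h1 : (Fin.succ (0 : Fin 2)).removeNth v = ![v 0, v 2] := by ext i; fin_cases i <;> rfl
  have h2 : (Fin.succ (1 : Fin 2)).removeNth v = ![v 0, v 1] := by ext i; fin_cases i <;> rfl
  simp only [Fin.sum_univ_succ (n := 2), Fin.sum_univ_two, key, h0, h1, h2, extDerivFundamental,
    ContinuousLinearMap.flip_apply]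
  simp
  ring

theorem fderiv_inChart_apply (he : e ∈ IsManifold.maximalAtlas 𝓘(ℂ, E) ω N)
    {u : E} (hu : u ∈ e.target) (a v w : E) :
    fderiv ℝ (g.inChart e) u a v w = fderiv ℝ (fun y => g.inChart e y v w) u a := by
  have hd := g.differentiableAt_inChart he hu
  rw [fderiv_clm_apply (hd.clm_apply (differentiableAt_const _)) (differentiableAt_const _),
    fderiv_clm_apply hd (differentiableAt_const _)]
  simp

theorem fderiv_inChart_symm (he : e ∈ IsManifold.maximalAtlas 𝓘(ℂ, E) ω N)
    {u : E} (hu : u ∈ e.target) (a v w : E) :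
    fderiv ℝ (g.inChart e) u a v w = fderiv ℝ (g.inChart e) u a w v := by
  simp only [g.fderiv_inChart_apply he hu, g.inChart_symm e _ v w]

theorem fderiv_inChart_mulI (he : e ∈ IsManifold.maximalAtlas 𝓘(ℂ, E) ω N)
    {u : E} (hu : u ∈ e.target) (a v w : E) :
    fderiv ℝ (g.inChart e) u a (mulI E v) (mulI E w) = fderiv ℝ (g.inChart e) u a v w := by
  have h : (fun y => g.inChart e y (mulI E v) (mulI E w)) =ᶠ[nhds u]
      fun y => g.inChart e y v w := by
    filter_upwards [e.open_target.mem_nhds hu] with y hy using g.inChart_mulI he hy v w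
  rw [g.fderiv_inChart_apply he hu, g.fderiv_inChart_apply he hu, h.fderiv_eq]

theorem inChart_christoffel (he : e ∈ IsManifold.maximalAtlas 𝓘(ℂ, E) ω N)
    {u : E} (hu : u ∈ e.target) (v w : E) :
    g.inChart e u (g.christoffel e u v w) = koszulForm (fderiv ℝ (g.inChart e) u) v w :=
  (g.isInvertible_inChart he hu).self_apply_inverse _

theorem christoffel_symm (he : e ∈ IsManifold.maximalAtlas 𝓘(ℂ, E) ω N)
    {u : E} (hu : u ∈ e.target) (v w : E) :
    g.christoffel e u v w = g.christoffel e u w v := by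
  apply (g.isInvertible_inChart he hu).injective
  rw [g.inChart_christoffel he hu, g.inChart_christoffel he hu]
  ext z
  rw [koszulForm_apply, koszulForm_apply, g.fderiv_inChart_symm he hu z v w]
  ring

/-- Lowering an index with the invertible metric turns the condition on Christoffel symbols into the
one on Koszul forms. -/
theorem extDeriv_fundamentalFormInChart_eq_zero_iff
    (he : e ∈ IsManifold.maximalAtlas 𝓘(ℂ, E) ω N) {u : E} (hu : u ∈ e.target) :
    extDeriv (g.fundamentalFormInChart e) u = 0 ↔
      ∀ v w, g.christoffel e u v w + g.christoffel e u (mulI E v) (mulI E w) = 0 := by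
  have h1 : extDeriv (g.fundamentalFormInChart e) u = 0 ↔
      ∀ a b c, extDerivFundamental (fderiv ℝ (g.inChart e) u) a b c = 0 := by
    constructor
    · intro h a b c
      have := g.extDeriv_fundamentalFormInChart_apply he hu ![a, b, c]
      rw [h] at this
      exact this.symm
    · intro h
      ext v
      rw [g.extDeriv_fundamentalFormInChart_apply he hu, h]
      rfl
  rw [h1, extDerivFundamental_eq_zero_iff (g.fderiv_inChart_symm he hu)
    (g.fderiv_inChart_mulI he hu)]
  refine forall₂_congr fun v w => ?_
  rw [← (g.isInvertible_inChart he hu).injective.eq_iff, map_add, map_zero,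
    g.inChart_christoffel he hu, g.inChart_christoffel he hu, ContinuousLinearMap.ext_iff]
  rfl

/-- A Hermitian metric is Kähler if and only if the `(1,1)`-part of the Christoffel symbols
vanishes in all holomorphic charts. -/
theorem isKaehler_iff : g.IsKaehler ↔ ∀ e ∈ IsManifold.maximalAtlas 𝓘(ℂ, E) ω N,
    ∀ u ∈ e.target, ∀ v w, g.christoffel e u v w +
      g.christoffel e u (mulI E v) (mulI E w) = 0 :=
  forall₂_congr fun _ he => forall₂_congr fun _ hu =>
    g.extDeriv_fundamentalFormInChart_eq_zero_iff he hu

end HermitianMetric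
end FundamentalForm

/-! ### The second fundamental form of ±holomorphic maps. -/

section SecondFundamentalForm

variable {E : Type*} [NormedAddCommGroup E] [NormedSpace ℂ E]
  {F : Type*} [NormedAddCommGroup F] [NormedSpace ℂ F]

theorem covariantHessian_apply (Γ : E → E →ₗ[ℝ] E →ₗ[ℝ] E) (Γ' : F → F →ₗ[ℝ] F →ₗ[ℝ] F)
    (f : E → F) (u v w : E) :
    covariantHessian Γ Γ' f u v w = fderiv ℝ (fderiv ℝ f) u v w - fderiv ℝ f u (Γ u v w)
      + Γ' (f u) (fderiv ℝ f u v) (fderiv ℝ f u w) := rfl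

/-- The second derivative of a map whose differential commutes with `J` up to a sign is
anti-invariant under `J`. -/
theorem fderiv_fderiv_mulI_mulI {f : E → F} {u : E} {s : ℝ} (hs : s * s = 1)
    (hf : ContDiffAt ℝ 2 f u)
    (hJ : ∀ᶠ y in nhds u, ∀ v, fderiv ℝ f y (mulI E v) = s • mulI F (fderiv ℝ f y v)) (v w : E) :
    fderiv ℝ (fderiv ℝ f) u (mulI E v) (mulI E w) = -fderiv ℝ (fderiv ℝ f) u v w := by
  have hd : DifferentiableAt ℝ (fderiv ℝ f) u :=
    (hf.fderiv_right (m := 1) (by norm_num)).differentiableAt one_ne_zero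
  have key : ∀ a w, fderiv ℝ (fderiv ℝ f) u a (mulI E w) =
      s • mulI F (fderiv ℝ (fderiv ℝ f) u a w) := by
    intro a w
    have h1 : (fun y => fderiv ℝ f y (mulI E w)) =ᶠ[nhds u]
        fun y => (s • mulI F) (fderiv ℝ f y w) := hJ.mono fun y hy => hy w
    have h2 := congrArg (fun L : E →L[ℝ] F => L a) h1.fderiv_eq
    have h3 := ((s • mulI F).hasFDerivAt.comp u
      (hd.clm_apply (differentiableAt_const w)).hasFDerivAt).fderiv
    simp only [Function.comp_def] at h3
    rw [h3, fderiv_clm_apply hd (differentiableAt_const _),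
      fderiv_clm_apply hd (differentiableAt_const _)] at h2
    simpa using h2
  have hsymm : IsSymmSndFDerivAt ℝ f u := hf.isSymmSndFDerivAt (by simp)
  -- `key` extracts `J` from the second slot only; symmetry of the second derivative brings the
  -- other `J` there. The total factor is `s² J² = -1`.
  rw [key, hsymm.eq (mulI E v) w, key, map_smul, mulI_mulI, smul_smul, hs, one_smul,
    hsymm.eq w v]

theorem covariantHessian_add_mulI (Γ : E → E →ₗ[ℝ] E →ₗ[ℝ] E) (Γ' : F → F →ₗ[ℝ] F →ₗ[ℝ] F)
    {f : E → F} {u : E} {s : ℝ} (hs : s * s = 1) (hf : ContDiffAt ℝ 2 f u)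
    (hJ : ∀ᶠ y in nhds u, ∀ v, fderiv ℝ f y (mulI E v) = s • mulI F (fderiv ℝ f y v)) (v w : E) :
    covariantHessian Γ Γ' f u v w + covariantHessian Γ Γ' f u (mulI E v) (mulI E w) =
      (Γ' (f u) (fderiv ℝ f u v) (fderiv ℝ f u w) +
        Γ' (f u) (mulI F (fderiv ℝ f u v)) (mulI F (fderiv ℝ f u w))) -
      fderiv ℝ f u (Γ u v w + Γ u (mulI E v) (mulI E w)) := by
  rw [covariantHessian_apply, covariantHessian_apply, fderiv_fderiv_mulI_mulI hs hf hJ,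
    hJ.self_of_nhds, hJ.self_of_nhds, map_smul, map_smul, LinearMap.smul_apply, smul_smul, hs,
    one_smul, map_add]
  abel

variable {N : Type*} [TopologicalSpace N] [ChartedSpace E N]
  {X : Type*} [TopologicalSpace X] [ChartedSpace F X]

/-- A sign `s = ±1` treats both cases at once; later only `s * s = 1` matters. -/
theorem exists_sign_of_isHolomorphicOn_or {φ : N → X} {U : Set N}
    (h : IsHolomorphicOn (E := E) (F := F) φ U ∨ IsAntiholomorphicOn (E := E) (F := F) φ U) :
    ContMDiffOn 𝓘(ℝ, E) 𝓘(ℝ, F) ∞ φ U ∧ ∃ s : ℝ, s * s = 1 ∧ ∀ x ∈ U, ∀ v : E,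
      (mfderiv 𝓘(ℝ, E) 𝓘(ℝ, F) φ x : E →L[ℝ] F) (mulI E v) =
        s • mulI F ((mfderiv 𝓘(ℝ, E) 𝓘(ℝ, F) φ x : E →L[ℝ] F) v) := by
  rcases h with h | h
  · refine ⟨h.1, 1, by norm_num, fun x hx v => ?_⟩
    rw [one_smul]
    exact h.2 x hx v
  · refine ⟨h.1, -1, by norm_num, fun x hx v => ?_⟩
    rw [neg_one_smul]
    exact h.2 x hx v

variable {e : OpenPartialHomeomorph N E} {e' : OpenPartialHomeomorph X F} {φ : N → X} {U : Set N}

/-- The local holomorphic map which is affine, with linear part `L`, in the charts `e`, `e'`. -/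
def affineInCharts (e : OpenPartialHomeomorph N E) (e' : OpenPartialHomeomorph X F) (u : E) (u' : F)
    (L : E →L[ℂ] F) : N → X :=
  fun x => e'.symm (u' + L (e x - u))

theorem isHolomorphicOn_affineInCharts (he : e ∈ IsManifold.maximalAtlas 𝓘(ℂ, E) ω N)
    (he' : e' ∈ IsManifold.maximalAtlas 𝓘(ℂ, F) ω X) (u : E) (u' : F) (L : E →L[ℂ] F) :
    IsOpen (e.source ∩ e ⁻¹' {z | u' + L (z - u) ∈ e'.target}) ∧
    IsHolomorphicOn (E := E) (F := F) (affineInCharts e e' u u' L)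
      (e.source ∩ e ⁻¹' {z | u' + L (z - u) ∈ e'.target}) := by
  have hA : ContDiff ℂ ω fun z : E => u' + L (z - u) :=
    contDiff_const.add (L.contDiff.comp (contDiff_id.sub contDiff_const))
  have hopen : IsOpen (e.source ∩ e ⁻¹' {z | u' + L (z - u) ∈ e'.target}) :=
    e.isOpen_inter_preimage (e'.open_target.preimage hA.continuous)
  refine ⟨hopen, ContMDiffOn.isHolomorphicOn hopen ?_⟩
  exact (contMDiffOn_symm_of_mem_maximalAtlas he').comp
    (hA.contMDiff.comp_contMDiffOn ((contMDiffOn_of_mem_maximalAtlas he).mono inter_subset_left))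
    fun x hx => hx.2

/-- By the chain rule: the differentials of the holomorphic charts commute with `J`, so the sign
comes from `φ` alone. -/
theorem fderiv_comp_charts_mulI (he : e ∈ IsManifold.maximalAtlas 𝓘(ℂ, E) ω N)
    (he' : e' ∈ IsManifold.maximalAtlas 𝓘(ℂ, F) ω X) (hU : IsOpen U)
    (hφ : ContMDiffOn 𝓘(ℝ, E) 𝓘(ℝ, F) ∞ φ U) {s : ℝ}
    (hJ : ∀ x ∈ U, ∀ v : E, (mfderiv 𝓘(ℝ, E) 𝓘(ℝ, F) φ x : E →L[ℝ] F) (mulI E v) =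
      s • mulI F ((mfderiv 𝓘(ℝ, E) 𝓘(ℝ, F) φ x : E →L[ℝ] F) v))
    {u : E} (hu : u ∈ e.target) (hxU : e.symm u ∈ U)
    (hx' : φ (e.symm u) ∈ e'.source) (v : E) :
    fderiv ℝ (e' ∘ φ ∘ e.symm) u (mulI E v) =
      s • mulI F (fderiv ℝ (e' ∘ φ ∘ e.symm) u v) := by
  have h1 : MDifferentiableAt 𝓘(ℂ, E) 𝓘(ℂ, E) e.symm u :=
    (contMDiffAt_symm_of_mem_maximalAtlas he hu).mdifferentiableAt (by simp)
  have h2 : MDifferentiableAt 𝓘(ℂ, F) 𝓘(ℂ, F) e' (φ (e.symm u)) :=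
    (contMDiffAt_of_mem_maximalAtlas he' hx').mdifferentiableAt (by simp)
  have h3 : MDifferentiableAt 𝓘(ℝ, E) 𝓘(ℝ, F) φ (e.symm u) :=
    (hφ.contMDiffAt (hU.mem_nhds hxU)).mdifferentiableAt (by simp)
  have h4 : ∀ v : E, fderiv ℝ (e' ∘ φ ∘ e.symm) u v =
      (mfderiv 𝓘(ℝ, F) 𝓘(ℝ, F) e' (φ (e.symm u)) : F →L[ℝ] F)
        ((mfderiv 𝓘(ℝ, E) 𝓘(ℝ, F) φ (e.symm u) : E →L[ℝ] F)
          ((mfderiv 𝓘(ℝ, E) 𝓘(ℝ, E) e.symm u : E →L[ℝ] E) v)) := by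
    intro v
    rw [← mfderiv_eq_fderiv, mfderiv_comp u h2.realOfComplex (h3.comp u h1.realOfComplex),
      mfderiv_comp u h3 h1.realOfComplex]
    rfl
  have h5 : ∀ w : F, (mfderiv 𝓘(ℝ, F) 𝓘(ℝ, F) e' (φ (e.symm u)) : F →L[ℝ] F) (mulI F w) =
      mulI F ((mfderiv 𝓘(ℝ, F) 𝓘(ℝ, F) e' (φ (e.symm u)) : F →L[ℝ] F) w) :=
    h2.mfderiv_complexStructure
  rw [h4, h4, mfderiv_symm_complexStructure he hu]
  refine (congrArg (mfderiv 𝓘(ℝ, F) 𝓘(ℝ, F) e' (φ (e.symm u)) : F →L[ℝ] F)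
    (hJ _ hxU ((mfderiv 𝓘(ℝ, E) 𝓘(ℝ, E) e.symm u : E →L[ℝ] E) v))).trans ?_
  exact ((mfderiv 𝓘(ℝ, F) 𝓘(ℝ, F) e' (φ (e.symm u)) : F →L[ℝ] F).map_smul s _).trans
    (congrArg (s • ·) (h5 _))

variable [IsManifold 𝓘(ℂ, E) ω N] [IsManifold 𝓘(ℂ, F) ω X]

theorem contDiffAt_comp_charts (he : e ∈ IsManifold.maximalAtlas 𝓘(ℂ, E) ω N)
    (he' : e' ∈ IsManifold.maximalAtlas 𝓘(ℂ, F) ω X) (hU : IsOpen U)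
    (hφ : ContMDiffOn 𝓘(ℝ, E) 𝓘(ℝ, F) ∞ φ U) {u : E} (hu : u ∈ e.target) (hxU : e.symm u ∈ U)
    (hx' : φ (e.symm u) ∈ e'.source) : ContDiffAt ℝ ∞ (e' ∘ φ ∘ e.symm) u := by
  rw [← contMDiffAt_iff_contDiffAt]
  have h1 : ContMDiffAt 𝓘(ℝ, E) 𝓘(ℝ, E) ∞ e.symm u :=
    (contMDiffAt_symm_of_mem_maximalAtlas (mem_maximalAtlas_real he) hu).of_le (by simp)
  have h2 : ContMDiffAt 𝓘(ℝ, F) 𝓘(ℝ, F) ∞ e' (φ (e.symm u)) :=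
    (contMDiffAt_of_mem_maximalAtlas (mem_maximalAtlas_real he') hx').of_le (by simp)
  exact h2.comp u ((hφ.contMDiffAt (hU.mem_nhds hxU)).comp u h1)

/-- The part of the second fundamental form of a `±`holomorphic map that is invariant under `J` is
determined by the first derivative of the map and the Christoffel symbols. -/
theorem secondFundamentalForm_add_mulI (g : HermitianMetric E N) (h : HermitianMetric F X)
    (he : e ∈ IsManifold.maximalAtlas 𝓘(ℂ, E) ω N)
    (he' : e' ∈ IsManifold.maximalAtlas 𝓘(ℂ, F) ω X) (hU : IsOpen U)
    (hφ : IsHolomorphicOn (E := E) (F := F) φ U ∨ IsAntiholomorphicOn (E := E) (F := F) φ U)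
    {u : E} (hu : u ∈ e.target) (hxU : e.symm u ∈ U)
    (hx' : φ (e.symm u) ∈ e'.source) {f : E → F} (hf : f = e' ∘ φ ∘ e.symm) (v w : E) :
    secondFundamentalForm g h φ e e' u v w +
      secondFundamentalForm g h φ e e' u (mulI E v) (mulI E w) =
      (h.christoffel e' (f u) (fderiv ℝ f u v) (fderiv ℝ f u w) +
        h.christoffel e' (f u) (mulI F (fderiv ℝ f u v)) (mulI F (fderiv ℝ f u w))) -
      fderiv ℝ f u (g.christoffel e u v w + g.christoffel e u (mulI E v) (mulI E w)) := by
  obtain ⟨hsmooth, s, hs, hJ⟩ := exists_sign_of_isHolomorphicOn_or hφ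
  subst hf
  refine covariantHessian_add_mulI _ _ hs
    ((contDiffAt_comp_charts he he' hU hsmooth hu hxU hx').of_le
      ENat.LEInfty.out) ?_ v w
  have hc : ContinuousAt e.symm u := e.symm.continuousAt hu
  have hφc : ContinuousAt φ (e.symm u) := hsmooth.continuousOn.continuousAt (hU.mem_nhds hxU)
  -- The commutation with `J` gets differentiated, so it is needed on a neighbourhood of `u`.
  filter_upwards [e.open_target.mem_nhds hu, hc (hU.mem_nhds hxU),
    (hφc.comp hc) (e'.open_source.mem_nhds hx')] with y hy1 hy2 hy3
  exact fderiv_comp_charts_mulI he he' hU hsmooth hJ hy1 hy2 hy3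

/-- If local holomorphic maps are `(1,1)`-geodesic, every complex linear map intertwines the
`(1,1)`-parts of the Christoffel symbols, at any pair of points. -/
theorem christoffel_intertwining (g : HermitianMetric E N) (h : HermitianMetric F X)
    (H : ∀ (U : Set N) (φ : N → X), IsOpen U →
      (IsHolomorphicOn (E := E) (F := F) φ U ∨ IsAntiholomorphicOn (E := E) (F := F) φ U) →
        IsOneOneGeodesicOn g h φ U)
    (he : e ∈ IsManifold.maximalAtlas 𝓘(ℂ, E) ω N)
    (he' : e' ∈ IsManifold.maximalAtlas 𝓘(ℂ, F) ω X) {u : E} (hu : u ∈ e.target)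
    {u' : F} (hu' : u' ∈ e'.target) (L : E →L[ℂ] F) (v w : E) :
    h.christoffel e' u' (L v) (L w) + h.christoffel e' u' (mulI F (L v)) (mulI F (L w)) =
      L (g.christoffel e u v w + g.christoffel e u (mulI E v) (mulI E w)) := by
  obtain ⟨hU, hφ⟩ := isHolomorphicOn_affineInCharts he he' u u' L
  have hxU : e.symm u ∈ e.source ∩ e ⁻¹' {z | u' + L (z - u) ∈ e'.target} :=
    ⟨e.map_target hu, by simpa [e.right_inv hu] using hu'⟩
  have hx' : affineInCharts e e' u u' L (e.symm u) ∈ e'.source := e'.map_target hxU.2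
  have h1 := (H _ _ hU (Or.inl hφ)).2 (e.symm u) hxU e he hxU.1 e' he' hx'
  rw [baseChange_eq_zero_iff, e.right_inv hu] at h1
  have h2 := secondFundamentalForm_add_mulI g h he he' hU (Or.inl hφ) hu hxU hx' rfl v w
  rw [h1] at h2
  have hA : HasFDerivAt (fun z : E => u' + L (z - u)) (L.restrictScalars ℝ) u :=
    ((L.restrictScalars ℝ).hasFDerivAt.comp u ((hasFDerivAt_id u).sub_const u)).const_add u'
  -- Near `u` the coordinate expression is the affine map itself, with value `u'` and differential
  -- `L` at `u`.
  have heq : (e' ∘ affineInCharts e e' u u' L ∘ e.symm) =ᶠ[nhds u] fun z => u' + L (z - u) := by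
    filter_upwards [e.open_target.mem_nhds hu, hA.continuousAt.preimage_mem_nhds
      (t := e'.target) (e'.open_target.mem_nhds (by simpa using hu'))] with y hy hy'
    simp only [affineInCharts, Function.comp_apply, e.right_inv hy]
    exact e'.right_inv hy'
  have hval : (e' ∘ affineInCharts e e' u u' L ∘ e.symm) u = u' := by
    rw [heq.self_of_nhds]; simp
  rw [heq.fderiv_eq, hA.fderiv, hval] at h2
  exact sub_eq_zero.1 h2.symm

end SecondFundamentalForm

end

/-! ### The equivalence. -/

theorem proposition3
    {E : Type*} [NormedAddCommGroup E] [NormedSpace ℂ E] [FiniteDimensional ℂ E] [Nontrivial E]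
    {F : Type*} [NormedAddCommGroup F] [NormedSpace ℂ F] [FiniteDimensional ℂ F] [Nontrivial F]
    {N : Type*} [TopologicalSpace N] [ChartedSpace E N] [IsManifold 𝓘(ℂ, E) ω N] [Nonempty N]
    {X : Type*} [TopologicalSpace X] [ChartedSpace F X] [IsManifold 𝓘(ℂ, F) ω X] [Nonempty X]
    (g : HermitianMetric E N) (h : HermitianMetric F X) :
    (∀ (U : Set N) (φ : N → X), IsOpen U →
        (IsHolomorphicOn (E := E) (F := F) φ U ∨ IsAntiholomorphicOn (E := E) (F := F) φ U) →
        IsOneOneGeodesicOn g h φ U) ↔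
      (g.IsKaehler ∧ h.IsKaehler) := by
  rw [g.isKaehler_iff, h.isKaehler_iff]
  constructor
  · intro H
    have hN : ∀ e ∈ IsManifold.maximalAtlas 𝓘(ℂ, E) ω N, ∀ u ∈ e.target, ∀ v w,
        g.christoffel e u v w + g.christoffel e u (mulI E v) (mulI E w) = 0 := by
      intro e he u hu v w
      by_contra h0
      -- The rank-one map `ℓ(·) b` with `b ≠ 0` does not kill the supposedly nonzero vector.
      obtain ⟨ℓ, hℓ⟩ := SeparatingDual.exists_ne_zero (R := ℂ) h0
      obtain ⟨b, hb⟩ := exists_ne (0 : F)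
      obtain ⟨y⟩ := ‹Nonempty X›
      have he' := IsManifold.chart_mem_maximalAtlas (I := 𝓘(ℂ, F)) (n := ω) y
      have hu' := mem_chart_target F y
      have h1 := christoffel_intertwining g h H he he' hu hu' (ℓ.smulRight b) v w
      -- Doubling `L` multiplies the left side by 4 and the right side by 2.
      have h2 := christoffel_intertwining g h H he he' hu hu' ((2 : ℝ) • ℓ.smulRight b) v w
      simp only [smul_apply, map_smul, LinearMap.smul_apply, ← smul_add] at h2
      rw [h1, smul_smul, ← sub_eq_zero, ← sub_smul] at h2
      have h3 := (smul_eq_zero.1 h2).resolve_left (by norm_num)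
      rw [ContinuousLinearMap.smulRight_apply] at h3
      exact (smul_eq_zero.1 h3).elim hℓ hb
    refine ⟨hN, fun e' he' u' hu' => ?_⟩
    obtain ⟨x⟩ := ‹Nonempty N›
    have he := IsManifold.chart_mem_maximalAtlas (I := 𝓘(ℂ, E)) (n := ω) x
    have hu := mem_chart_target E x
    obtain ⟨v, hv⟩ := exists_ne (0 : E)
    obtain ⟨ℓ, hℓ⟩ := SeparatingDual.exists_eq_one (R := ℂ) hv
    have hdiag : ∀ y, h.christoffel e' u' y y +
        h.christoffel e' u' (mulI F y) (mulI F y) = 0 := by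
      intro y
      -- Since `ℓ v = 1`, this `L` sends `v` to the arbitrary vector `y`.
      have h1 := christoffel_intertwining g h H he he' hu hu' (ℓ.smulRight y) v v
      rw [hN _ he _ hu, map_zero] at h1
      simpa [hℓ] using h1
    intro v w
    -- Polarization, using that the Christoffel symbols are symmetric.
    have h1 := hdiag (v + w)
    simp only [map_add, LinearMap.add_apply] at h1
    rw [h.christoffel_symm he' hu' w v, h.christoffel_symm he' hu' (mulI F w) (mulI F v)] at h1
    have h2 := congrArg₂ (· - ·) h1 (congrArg₂ (· + ·) (hdiag v) (hdiag w))
    simp only [add_zero, sub_zero] at h2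
    have h3 : (2 : ℝ) • (h.christoffel e' u' v w +
        h.christoffel e' u' (mulI F v) (mulI F w)) = 0 := by
      refine Eq.trans ?_ h2
      rw [two_smul]
      abel
    exact (smul_eq_zero.1 h3).resolve_left two_ne_zero
  · rintro ⟨hN, hX⟩ U φ hU hφ
    refine ⟨(exists_sign_of_isHolomorphicOn_or hφ).1, fun x hx e he hxe e' he' hxe' => ?_⟩
    rw [baseChange_eq_zero_iff]
    intro v w
    have hxx := e.left_inv hxe
    rw [secondFundamentalForm_add_mulI g h he he' hU hφ (e.map_source hxe) (by rwa [hxx])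
      (by rwa [hxx]) rfl, hN e he _ (e.map_source hxe), map_zero, sub_zero]
    refine hX e' he' _ ?_ _ _
    simpa [hxx] using e'.map_source hxe'
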